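/- For a finite simple graph $G$, let $N(x)$ denote the set of neighbors of a node $x$. Define the color refinement colorings $C_r=C_r^G$ of the nodes of $G$ by $C_0(x)=\deg x$ and, for $r\ge 1$, by letting $C_r(x)$ be the multiset $\{\!\{C_{r-1}(y) : y\in N(x)\}\!\}$. Let $S_r(G)=\{C_r(v) : v\in V(G)\}$ be the set (without multiplicities) of node colors in round $r$. Let $G\sim G(n,1/2)$ be a random graph on $n$ labeled nodes in which each pair of distinct nodes is an edge with probability $1/2$, independently (equivalently, $G$ is uniform among all graphs on $\{1,\dots,n\}$). With probability tending to $1$ as $n\to\infty$, the following three statements hold: 1. $S_4(G)\cap S_4(H)=\emptyset$ for every $n$-node graph $H\not\cong G$; 2. $S_3(G)\cap S_3(H)\neq\emptyset$ for some $n$-node graph $H\not\cong G$; 3. $S_2(G)\neq S_2(H)$ for every $n$-node graph $H\not\cong G$. -/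

import Mathlib

open Filter Topology

/-- The type of colors used in round `r` of color refinement: natural numbers in round `0`,
and finite multisets of round-`r` colors in round `r + 1`. -/
def CRColor : ℕ → Type
  | 0 => ℕ
  | r + 1 => Multiset (CRColor r)

open Classical in
/-- The coloring `C_r` of color refinement on a finite simple graph: `C_0(x)` is the degree of `x`,
and `C_{r+1}(x)` is the multiset of the colors `C_r(y)` over all neighbors `y` of `x`. -/
noncomputable def SimpleGraph.crColor {V : Type*} [Fintype V] (G : SimpleGraph V) :
    (r : ℕ) → V → CRColor r
  | 0 => fun x => G.degree x
  | r + 1 => fun x => (G.neighborFinset x).val.map (G.crColor r)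

/-- The set `S_r(G)` of node colors produced by color refinement in round `r`. -/
def SimpleGraph.crColorSet {V : Type*} [Fintype V] (G : SimpleGraph V) (r : ℕ) :
    Set (CRColor r) :=
  Set.range (G.crColor r)

/-- The distribution of the random graph `G(n, 1/2)` on `n` labeled nodes. -/
noncomputable def randomGraphHalf (n : ℕ) : MeasureTheory.Measure (SimpleGraph (Fin n)) :=
  SimpleGraph.binomialRandom (Fin n) ⟨1 / 2, by norm_num, by norm_num⟩

/-! Everything rests on one almost sure event: `C_1` separates the vertices of `G`. Given this, a
color of round 2 determines the neighborhood of its vertex, so `S_2(G)` determines `G` up to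
isomorphism; and if any two vertices are also joined by a walk of length 2, a single shared color of
round 4 already reveals all of `S_2(G)` (`crColorSet_inter_eq_empty`). For the negative statement,
fix `x` and find, among the non-neighbors of `x`, an alternating 4-cycle on vertices of equal
degree. Switching it keeps `C_1` everywhere and `C_3(x)`, but changes the graph, and injectivity of
`C_1` makes the result non-isomorphic (`exists_switch`).

The probabilistic input is counting by resampling: rerandomize the edges between two disjoint vertex
sets and bound the bad outcomes (`density_le_of_resample`). For `C_1(u) = C_1(v)`, the resampled
edges join six neighbors of `u` alone to about `n/8` common neighbors of `u` and `v`. The common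
neighbors cancel in the comparison, so each of the six degrees must fall in a fixed set of at most
six values. This has probability `O(n^(-1/2))` for each, `O(n^(-3))` for all, which beats the `n^2`
pairs. Degree concentration and pigeonhole provide `4k` non-neighbors of `x` of equal degree, and a
union bound shows that any such set contains an alternating 4-cycle. -/

namespace SimpleGraph

/-! ### Color refinement and reconstruction of a graph from its colors -/

variable {V W : Type*} [Fintype V] [Fintype W]

/-- The color of a vertex in round `r`, recovered from its color in round `r + 1`. -/
def _root_.CRColor.pred : (r : ℕ) → CRColor (r + 1) → CRColor r
  | 0 => fun c => Multiset.card (α := CRColor 0) c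
  | r + 1 => fun c => Multiset.map (CRColor.pred r) c

open Classical in
theorem crColor_zero (G : SimpleGraph V) (x : V) : G.crColor 0 x = G.degree x := rfl

open Classical in
theorem crColor_succ (G : SimpleGraph V) (r : ℕ) (x : V) :
    G.crColor (r + 1) x = (G.neighborFinset x).val.map (G.crColor r) := rfl

theorem pred_crColor (G : SimpleGraph V) (r : ℕ) (x : V) :
    CRColor.pred r (G.crColor (r + 1) x) = G.crColor r x := by
  induction r generalizing x with
  | zero =>
    classical
    rw [crColor_succ, crColor_zero]
    exact (Multiset.card_map _ _)
  | succ r ih =>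
    rw [crColor_succ, crColor_succ G r]
    refine (Multiset.map_map _ _ _).trans (Multiset.map_congr rfl fun y _ => ih y)

/-- Copies walks from `G` to `H`, at the cost of one round per step. -/
theorem exists_adj_of_crColor_eq {G : SimpleGraph V} {H : SimpleGraph W} {r : ℕ} {x : V} {y : W}
    (h : G.crColor (r + 1) x = H.crColor (r + 1) y) {x' : V} (hx : G.Adj x x') :
    ∃ y', H.Adj y y' ∧ G.crColor r x' = H.crColor r y' := by
  classical
  rw [crColor_succ, crColor_succ] at h
  have : G.crColor r x' ∈ (G.neighborFinset x).val.map (G.crColor r) :=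
    Multiset.mem_map_of_mem _ (by simpa using hx)
  rw [h] at this
  obtain ⟨y', hy, e⟩ := Multiset.mem_map.1 this
  exact ⟨y', by simpa using hy, e.symm⟩

/-- Colors refine, so `e` also preserves round `r`, where both colorings are then injective. The
neighbor of `e a` that matches `b` can therefore only be `e b`. -/
theorem nonempty_iso_of_crColor {G : SimpleGraph V} {H : SimpleGraph W} {r : ℕ}
    (hG : Function.Injective (G.crColor r)) (e : V ≃ W)
    (h : ∀ x, G.crColor (r + 1) x = H.crColor (r + 1) (e x)) : Nonempty (G ≃g H) := by
  have h' : ∀ x, G.crColor r x = H.crColor r (e x) := fun x => by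
    rw [← pred_crColor, h, pred_crColor]
  have hH : Function.Injective (H.crColor r) := fun a b hab => by
    obtain ⟨a, rfl⟩ := e.surjective a
    obtain ⟨b, rfl⟩ := e.surjective b
    rw [← h', ← h'] at hab
    rw [hG hab]
  refine ⟨⟨e, fun {a b} => ⟨fun hab => ?_, fun hab => ?_⟩⟩⟩
  · obtain ⟨b', hb, hc⟩ := exists_adj_of_crColor_eq (h a).symm hab
    rw [← h'] at hc
    rwa [hG hc]
  · obtain ⟨b', hb, hc⟩ := exists_adj_of_crColor_eq (h a) hab
    rw [h'] at hc
    rwa [hH hc]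

theorem nonempty_iso_of_crColorSet_subset {G H : SimpleGraph V} {r : ℕ}
    (hG : Function.Injective (G.crColor r))
    (h : G.crColorSet (r + 1) ⊆ H.crColorSet (r + 1)) : Nonempty (G ≃g H) := by
  have h' : ∀ x, ∃ y, H.crColor (r + 1) y = G.crColor (r + 1) x := fun x => h ⟨x, rfl⟩
  choose f hf using h'
  have hinj : Function.Injective f := fun a b hab => hG <| by
    rw [← pred_crColor, ← hf, hab, hf, pred_crColor]
  exact nonempty_iso_of_crColor hG (Equiv.ofBijective f (Finite.injective_iff_bijective.1 hinj))
    fun x => (hf x).symm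

/-- A shared color at `x` and `y` lets every walk of length 2 from `x` be copied from `y`. These
walks reach all vertices, so every color of round `r + 1` of `G` occurs in `H`. -/
theorem crColorSet_inter_eq_empty {G H : SimpleGraph V} {r : ℕ}
    (hG : Function.Injective (G.crColor r)) (hwalk : ∀ x w, ∃ y, G.Adj x y ∧ G.Adj y w)
    (hiso : ¬ Nonempty (G ≃g H)) : G.crColorSet (r + 3) ∩ H.crColorSet (r + 3) = ∅ := by
  rw [Set.eq_empty_iff_forall_notMem]
  rintro _ ⟨⟨x, rfl⟩, ⟨y, hy⟩⟩
  refine hiso (nonempty_iso_of_crColorSet_subset hG ?_)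
  rintro _ ⟨w, rfl⟩
  obtain ⟨u, hxu, huw⟩ := hwalk x w
  obtain ⟨u', -, hu⟩ := exists_adj_of_crColor_eq hy.symm hxu
  obtain ⟨w', -, hw⟩ := exists_adj_of_crColor_eq hu huw
  exact ⟨w', hw.symm⟩

theorem crColor_iso {G : SimpleGraph V} {H : SimpleGraph W} (e : G ≃g H) (r : ℕ) (x : V) :
    H.crColor r (e x) = G.crColor r x := by
  classical
  induction r generalizing x with
  | zero => rw [crColor_zero, crColor_zero]; exact e.degree_eq x
  | succ r ih =>
    rw [crColor_succ, crColor_succ]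
    have : H.neighborFinset (e x) = (G.neighborFinset x).map e.toEquiv.toEmbedding := by
      ext y
      simp only [mem_neighborFinset, Finset.mem_map_equiv]
      change _ ↔ G.Adj x (e.symm y)
      rw [← e.map_adj_iff, e.apply_symm_apply]
    rw [this, Finset.map_val, Multiset.map_map]
    exact Multiset.map_congr rfl fun y _ => ih y

/-- An isomorphism preserves colors, hence fixes every vertex when the two colorings agree and are
injective. -/
theorem eq_of_crColor_eq_of_iso {G H : SimpleGraph V} {r : ℕ}
    (hG : Function.Injective (G.crColor r)) (h : H.crColor r = G.crColor r) (e : G ≃g H) :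
    G = H := by
  have he : ∀ x, e x = x := fun x => hG <| by rw [← h, crColor_iso, h]
  ext a b
  rw [← e.map_adj_iff, he, he]

/-! ### Switching an alternating 4-cycle -/

open Classical in
theorem neighborFinset_eq_map_perm {G H : SimpleGraph V} {w : V} {σ : Equiv.Perm V}
    (h : ∀ v, H.Adj w (σ v) ↔ G.Adj w v) :
    H.neighborFinset w = (G.neighborFinset w).map σ.toEmbedding := by
  ext y
  rw [Finset.mem_map_equiv, mem_neighborFinset, mem_neighborFinset, ← h, Equiv.apply_symm_apply]

/-- Permuting each neighborhood along equal degrees does not change the colors of round `1`. -/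
theorem crColor_one_eq_of_perm {G H : SimpleGraph V}
    (h : ∀ w, ∃ σ : Equiv.Perm V, (∀ v, G.crColor 0 (σ v) = G.crColor 0 v) ∧
      ∀ v, H.Adj w (σ v) ↔ G.Adj w v) : H.crColor 1 = G.crColor 1 := by
  classical
  have h0 : H.crColor 0 = G.crColor 0 := by
    funext w
    obtain ⟨σ, -, hσ⟩ := h w
    rw [crColor_zero, crColor_zero, ← card_neighborFinset_eq_degree,
      ← card_neighborFinset_eq_degree, neighborFinset_eq_map_perm hσ, Finset.card_map]
  funext w
  obtain ⟨σ, hd, hσ⟩ := h w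
  rw [crColor_succ, crColor_succ, neighborFinset_eq_map_perm hσ, Finset.map_val,
    Multiset.map_map, h0]
  exact Multiset.map_congr rfl fun y _ => hd y

/-- The result of switching the edges `ab`, `cd` to `ad`, `cb`. -/
def switch (G : SimpleGraph V) (a b c d : V) : SimpleGraph V :=
  symmDiff G (fromEdgeSet {s(a, b), s(c, d), s(a, d), s(c, b)})

/-- Switching exchanges neighbors of equal degree, so `C_1` is unchanged. As the four vertices avoid
`x` and its neighbors, the neighborhoods of `x` and of all its neighbors survive, hence so does
`C_3(x)`. An isomorphism would force equality of the graphs, but the edge `ab` is lost. -/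
theorem exists_switch {G : SimpleGraph V} {a b c d x : V} (hG : Function.Injective (G.crColor 1))
    (hab : G.Adj a b) (hcd : G.Adj c d) (had : ¬ G.Adj a d) (hcb : ¬ G.Adj c b)
    (nad : a ≠ d) (ncb : c ≠ b)
    (hac : G.crColor 0 a = G.crColor 0 c) (hbd : G.crColor 0 b = G.crColor 0 d)
    (hx : ∀ y ∈ ({a, b, c, d} : Set V), y ≠ x ∧ ¬ G.Adj x y) :
    ∃ H : SimpleGraph V, ¬ Nonempty (G ≃g H) ∧ G.crColorSet 3 ∩ H.crColorSet 3 ≠ ∅ := by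
  classical
  have nab := hab.ne
  have ncd := hcd.ne
  have nac : a ≠ c := fun h => hcb (h ▸ hab)
  have nbd : b ≠ d := fun h => had (h ▸ hab)
  have hadj : ∀ u v, (G.switch a b c d).Adj u v ↔ Xor (G.Adj u v)
      ((u = a ∧ v = b ∨ u = b ∧ v = a ∨ u = c ∧ v = d ∨ u = d ∧ v = c) ∨
        (u = a ∧ v = d ∨ u = d ∧ v = a ∨ u = c ∧ v = b ∨ u = b ∧ v = c)) := by
    intro u v
    simp only [switch, symmDiff, sup_adj, sdiff_adj, fromEdgeSet_adj, Set.mem_insert_iff,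
      Set.mem_singleton_iff, Sym2.eq_iff, Xor]
    grind
  have hb := hab.symm
  have hd := hcd.symm
  have hda : ¬ G.Adj d a := fun h => had h.symm
  have hbc : ¬ G.Adj b c := fun h => hcb h.symm
  have hout : ∀ u, u ≠ a → u ≠ b → u ≠ c → u ≠ d → ∀ v,
      (G.switch a b c d).Adj u v ↔ G.Adj u v := by
    intro u h1 h2 h3 h4 v
    rw [hadj]; simp [h1, h2, h3, h4, Xor]
  have h1 : (G.switch a b c d).crColor 1 = G.crColor 1 := by
    refine crColor_one_eq_of_perm fun w => ?_
    by_cases hw : w = a ∨ w = c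
    · refine ⟨Equiv.swap b d, fun v => ?_, fun v => ?_⟩
      · rw [Equiv.swap_apply_def]; split_ifs <;> simp_all
      · rw [hadj, Equiv.swap_apply_def, Xor]
        split_ifs <;> grind
    by_cases hw' : w = b ∨ w = d
    · refine ⟨Equiv.swap a c, fun v => ?_, fun v => ?_⟩
      · rw [Equiv.swap_apply_def]; split_ifs <;> simp_all
      · rw [hadj, Equiv.swap_apply_def, Xor]
        split_ifs <;> grind
    · exact ⟨Equiv.refl V, fun v => rfl, hout w (by tauto) (by tauto) (by tauto) (by tauto)⟩
  refine ⟨G.switch a b c d, fun ⟨e⟩ => ?_, ?_⟩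
  · have := eq_of_crColor_eq_of_iso hG h1 e
    have h2 := hadj a b
    rw [← this] at h2
    simp [hab, Xor] at h2
  · have hN : ∀ u, u ≠ a → u ≠ b → u ≠ c → u ≠ d →
        (G.switch a b c d).neighborFinset u = G.neighborFinset u := by
      intro u h1 h2 h3 h4
      ext v
      rw [mem_neighborFinset, mem_neighborFinset, hout u h1 h2 h3 h4]
    have hax := hx a (by simp)
    have hbx := hx b (by simp)
    have hcx := hx c (by simp)
    have hdx := hx d (by simp)
    have h3 : (G.switch a b c d).crColor 3 x = G.crColor 3 x := by
      rw [crColor_succ, crColor_succ G, hN x hax.1.symm hbx.1.symm hcx.1.symm hdx.1.symm]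
      refine Multiset.map_congr rfl fun u hu => ?_
      have hu : G.Adj x u := by simpa using hu
      rw [crColor_succ, crColor_succ G, h1, hN u] <;> rintro rfl <;> tauto
    exact Set.nonempty_iff_ne_empty.1 ⟨_, ⟨x, rfl⟩, ⟨x, h3⟩⟩

end SimpleGraph

/-! ### The uniform measure on graphs -/

namespace SimpleGraph

theorem _root_.ncard_eq_card_filter {κ : Type*} [Fintype κ] (P : κ → Prop) [DecidablePred P] :
    {x | P x}.ncard = (Finset.univ.filter P).card := by
  rw [Set.ncard_eq_toFinset_card', Set.toFinset_ofPred]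

section Density

variable {V : Type*}

/-- The proportion of graphs on `V` with a given property. -/
noncomputable def density (P : SimpleGraph V → Prop) : ℝ :=
  {G | P G}.ncard / Nat.card (SimpleGraph V)

theorem card_graphs_pos [Fintype (SimpleGraph V)] : (0 : ℝ) < Fintype.card (SimpleGraph V) := by
  exact_mod_cast Fintype.card_pos

theorem density_eq [Fintype (SimpleGraph V)] (P : SimpleGraph V → Prop) [DecidablePred P] :
    density P = (Finset.univ.filter P).card / Fintype.card (SimpleGraph V) := by
  rw [density, Nat.card_eq_fintype_card, ncard_eq_card_filter]

theorem density_nonneg (P : SimpleGraph V → Prop) : 0 ≤ density P := by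
  unfold density; positivity

variable [Finite V]

theorem density_mono {P Q : SimpleGraph V → Prop} (h : ∀ G, P G → Q G) :
    density P ≤ density Q := by
  classical
  cases nonempty_fintype V
  simp only [density_eq]
  gcongr
  exact h _

theorem density_or_le (P Q : SimpleGraph V → Prop) :
    density (fun G => P G ∨ Q G) ≤ density P + density Q := by
  classical
  cases nonempty_fintype V
  simp only [density_eq]
  rw [← add_div, Finset.filter_or]
  gcongr
  exact_mod_cast Finset.card_union_le _ _

theorem density_exists_le {ι : Type*} [Fintype ι] (P : ι → SimpleGraph V → Prop) :
    density (fun G => ∃ i, P i G) ≤ ∑ i, density (P i) := by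
  classical
  cases nonempty_fintype V
  simp only [density_eq]
  rw [← Finset.sum_div]
  gcongr
  have : Finset.univ.filter (fun G => ∃ i, P i G) =
      Finset.univ.biUnion fun i => Finset.univ.filter (P i) := by
    ext; simp
  rw [this]
  exact_mod_cast Finset.card_biUnion_le

theorem density_exists_le_mul {ι : Type*} [Fintype ι] (P : ι → SimpleGraph V → Prop) {c : ℝ}
    (h : ∀ i, density (P i) ≤ c) : density (fun G => ∃ i, P i G) ≤ Fintype.card ι * c := by
  refine (density_exists_le P).trans ?_
  simpa using Finset.sum_le_sum fun i (_ : i ∈ Finset.univ) => h i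

theorem density_not (P : SimpleGraph V → Prop) : density (fun G => ¬ P G) = 1 - density P := by
  classical
  cases nonempty_fintype V
  simp only [density_eq]
  have := Finset.card_filter_add_card_filter_not (s := (Finset.univ : Finset (SimpleGraph V))) P
  rw [Finset.card_univ] at this
  rw [eq_sub_iff_add_eq, ← add_div, div_eq_one_iff_eq card_graphs_pos.ne', add_comm]
  exact_mod_cast this

theorem density_le_one (P : SimpleGraph V → Prop) : density P ≤ 1 := by
  have := density_not P
  linarith [density_nonneg fun G => ¬ P G]

/-- Law of total probability: a bound conditional on each value of `f` holds overall. -/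
theorem density_le_of_fiberwise {κ : Type*} [Fintype κ] (f : SimpleGraph V → κ)
    (P : SimpleGraph V → Prop) {c : ℝ}
    (h : ∀ k, density (fun G => f G = k ∧ P G) ≤ c * density fun G => f G = k) :
    density P ≤ c := by
  classical
  cases nonempty_fintype V
  have h1 : ∀ Q : SimpleGraph V → Prop, density Q = ∑ k, density (fun G => f G = k ∧ Q G) := by
    intro Q
    simp only [density_eq]
    rw [← Finset.sum_div]
    congr 1
    rw [Finset.card_eq_sum_card_fiberwise (f := f) (t := Finset.univ) (by simp)]
    push_cast
    simp_rw [Finset.filter_filter, and_comm]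
  have h2 : density (fun _ : SimpleGraph V => True) = 1 := by
    simp only [density_eq]
    simp
  rw [h1]
  calc _ ≤ ∑ k, c * density (fun G => f G = k ∧ True) :=
        Finset.sum_le_sum fun k _ => by simpa using h k
    _ = c := by rw [← Finset.mul_sum, ← h1, h2, mul_one]

end Density

theorem _root_.randomGraphHalf_eq_density (n : ℕ) (P : SimpleGraph (Fin n) → Prop) :
    randomGraphHalf n {G | P G} = ENNReal.ofReal (density P) := by
  classical
  obtain ⟨c, hc⟩ : ∃ c, ∀ G : SimpleGraph (Fin n), randomGraphHalf n {G} = c := by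
    refine ⟨(2⁻¹ : ENNReal) ^ (n.choose 2), fun G => ?_⟩
    have h1 : (unitInterval.toNNReal ⟨1 / 2, by norm_num, by norm_num⟩ : ENNReal) = 2⁻¹ := by
      rw [← ENNReal.coe_ofNat, ← ENNReal.coe_inv (by norm_num), ENNReal.coe_inj]
      ext
      change (1 / 2 : ℝ) = 2⁻¹
      norm_num
    have h2 : (unitInterval.toNNReal (unitInterval.symm ⟨1 / 2, by norm_num, by norm_num⟩) :
        ENNReal) = 2⁻¹ := by
      rw [← ENNReal.coe_ofNat, ← ENNReal.coe_inv (by norm_num), ENNReal.coe_inj]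
      ext
      change (1 - 1 / 2 : ℝ) = 2⁻¹
      norm_num
    rw [randomGraphHalf, binomialRandom_singleton, h1, h2, ← pow_add, Nat.card_eq_fintype_card,
      Fintype.card_fin, Nat.add_sub_cancel']
    rw [Set.ncard_eq_toFinset_card', ← edgeFinset]
    simpa using G.card_edgeFinset_le_card_choose_two
  have hm : MeasurableSingletonClass (SimpleGraph (Fin n)) := ⟨fun G => by
    have : {G} = edgeSet ⁻¹' {G.edgeSet} := by ext H; simp
    rw [this]
    exact measurable_edgeSet (measurableSet_singleton _)⟩
  have hS : ∀ Q : SimpleGraph (Fin n) → Prop,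
      randomGraphHalf n {G | Q G} = (Finset.univ.filter Q).card * c := by
    intro Q
    have : {G | Q G} = ((Finset.univ.filter Q : Finset (SimpleGraph (Fin n))) : Set _) := by
      ext; simp
    rw [this, ← MeasureTheory.sum_measure_singleton]
    simp [hc]
  have hprob : MeasureTheory.IsProbabilityMeasure (randomGraphHalf n) := by
    unfold randomGraphHalf; infer_instance
  have h1 : (Fintype.card (SimpleGraph (Fin n)) : ENNReal) * c = 1 := by
    have := hS fun _ => True
    simpa using this.symm
  have hc' : c = (Fintype.card (SimpleGraph (Fin n)) : ENNReal)⁻¹ :=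
    ENNReal.eq_inv_of_mul_eq_one_left (by rwa [mul_comm])
  rw [hS, hc', density_eq, ENNReal.ofReal_div_of_pos card_graphs_pos, ENNReal.ofReal_natCast,
    ENNReal.ofReal_natCast, div_eq_mul_inv]

/-! ### Resampling the edges between two disjoint sets -/

section Resample

variable {V α β : Type*}

/-- Replace the edges between the vertices `p i` and `q j` by those with `j ∈ η i`. -/
def resample (G : SimpleGraph V) (p : α → V) (q : β → V) (η : α → Finset β) : SimpleGraph V where
  Adj a b := a ≠ b ∧ ((∃ i j, j ∈ η i ∧ (a = p i ∧ b = q j ∨ a = q j ∧ b = p i)) ∨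
    (G.Adj a b ∧ ¬ ∃ i j, (a = p i ∧ b = q j ∨ a = q j ∧ b = p i)))
  symm := ⟨by
    rintro a b ⟨h, h'⟩
    refine ⟨h.symm, ?_⟩
    simpa only [G.adj_comm b a, or_comm, and_comm] using h'⟩
  loopless := ⟨fun a h => h.1 rfl⟩

/-- The neighborhoods of the vertices `p i` among the vertices `q j`. -/
noncomputable def rows [Fintype β] (G : SimpleGraph V) (p : α → V) (q : β → V) (i : α) :
    Finset β :=
  open Classical in Finset.univ.filter fun j => G.Adj (p i) (q j)

variable {p : α → V} {q : β → V} (hp : Function.Injective p) (hq : Function.Injective q)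
  (hpq : ∀ i j, p i ≠ q j)

include hp hq hpq in
theorem resample_adj (G : SimpleGraph V) (η : α → Finset β) (i : α) (j : β) :
    (G.resample p q η).Adj (p i) (q j) ↔ j ∈ η i := by
  constructor
  · rintro ⟨-, ⟨i', j', h, ⟨h1, h2⟩ | ⟨h1, h2⟩⟩ | ⟨-, h⟩⟩
    · rwa [hp h1, hq h2]
    · exact absurd h1 (hpq _ _)
    · exact absurd ⟨i, j, Or.inl ⟨rfl, rfl⟩⟩ h
  · exact fun h => ⟨hpq i j, Or.inl ⟨i, j, h, Or.inl ⟨rfl, rfl⟩⟩⟩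

theorem resample_adj_of_notMem (G : SimpleGraph V) (η : α → Finset β) {a b : V}
    (h : ∀ i j, ¬ (a = p i ∧ b = q j) ∧ ¬ (a = q j ∧ b = p i)) :
    (G.resample p q η).Adj a b ↔ G.Adj a b := by
  constructor
  · rintro ⟨-, ⟨i', j', -, h' | h'⟩ | ⟨h', -⟩⟩
    · exact absurd h' (h _ _).1
    · exact absurd h' (h _ _).2
    · exact h'
  · exact fun h' => ⟨h'.ne, Or.inr ⟨h', fun ⟨i, j, hij⟩ => hij.elim (h i j).1 (h i j).2⟩⟩

include hp hq hpq in
theorem rows_resample [Fintype β] (G : SimpleGraph V) (η : α → Finset β) :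
    (G.resample p q η).rows p q = η := by
  funext i
  ext j
  simp [rows, resample_adj hp hq hpq]

include hp hq hpq in
theorem resample_resample_rows [Fintype β] (G : SimpleGraph V) (η : α → Finset β) :
    (G.resample p q η).resample p q (G.rows p q) = G := by
  ext a b
  by_cases h : ∀ i j, ¬ (a = p i ∧ b = q j) ∧ ¬ (a = q j ∧ b = p i)
  · rw [resample_adj_of_notMem _ _ h, resample_adj_of_notMem _ _ h]
  · push Not at h
    obtain ⟨i, j, h⟩ := h
    by_cases h' : a = p i ∧ b = q j
    · rw [h'.1, h'.2, resample_adj hp hq hpq]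
      simp [rows]
    · have := h (fun h1 h2 => h' ⟨h1, h2⟩)
      rw [this.1, this.2, adj_comm, resample_adj hp hq hpq, adj_comm]
      simp [rows]

include hp hq hpq in
/-- If a property is rarely satisfied after resampling the edges between two disjoint sets of
vertices, then it is rare. -/
theorem density_le_of_resample [Fintype V] [Fintype α] [Fintype β] {P Q : SimpleGraph V → Prop}
    {c : ℝ} (hPQ : ∀ G, P G → Q G) (hQ : ∀ G η, Q G → Q (G.resample p q η))
    (h : ∀ G, Q G → ({η : α → Finset β | P (G.resample p q η)}.ncard : ℝ) ≤
      c * Nat.card (α → Finset β)) :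
    density P ≤ c * density Q := by
  classical
  simp only [ncard_eq_card_filter, Nat.card_eq_fintype_card] at h
  simp only [density_eq]
  rw [← mul_div_assoc]
  gcongr
  have hι : (0 : ℝ) < Fintype.card (α → Finset β) := by exact_mod_cast Fintype.card_pos
  refine le_of_mul_le_mul_right ?_ hι
  -- Double counting: `(G, η) ↦ (resampled G, old rows)` is injective because resampling with the
  -- old rows undoes it.
  have h1 : (Finset.univ.filter P).card * Fintype.card (α → Finset β) ≤
      ((Finset.univ.filter Q).sigma fun G =>
        Finset.univ.filter fun η : α → Finset β => P (G.resample p q η)).card := by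
    rw [← Finset.card_univ, ← Finset.card_product]
    refine Finset.card_le_card_of_injOn
      (fun x => ⟨x.1.resample p q x.2, x.1.rows p q⟩) ?_ ?_
    · rintro ⟨G, η⟩ hG
      have hG : P G := by simpa using hG
      simp only [Finset.coe_sigma, Set.mem_sigma_iff, Finset.mem_coe, Finset.mem_filter,
        Finset.mem_univ, true_and]
      rw [resample_resample_rows hp hq hpq]
      exact ⟨hQ _ _ (hPQ _ hG), hG⟩
    · rintro ⟨G, η⟩ - ⟨G', η'⟩ - heq
      simp only [Sigma.mk.injEq, heq_eq_eq] at heq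
      have e1 := resample_resample_rows hp hq hpq G η
      have e2 := rows_resample hp hq hpq G η
      rw [heq.1] at e1 e2
      rw [heq.2, resample_resample_rows hp hq hpq] at e1
      rw [rows_resample hp hq hpq] at e2
      rw [e1, e2]
  rw [Finset.card_sigma] at h1
  have h2 : ((Finset.univ.filter P).card : ℝ) * Fintype.card (α → Finset β) ≤
      ∑ G ∈ Finset.univ.filter Q,
        ((Finset.univ.filter fun η : α → Finset β => P (G.resample p q η)).card : ℝ) := by
    exact_mod_cast h1
  calc _ ≤ _ := h2
    _ ≤ ∑ G ∈ Finset.univ.filter Q, c * Fintype.card (α → Finset β) :=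
      Finset.sum_le_sum fun G hG => h G (by simpa using hG)
    _ = _ := by rw [Finset.sum_const, nsmul_eq_mul]; ring

end Resample

end SimpleGraph

/-! ### Moments and anticoncentration of the size of a random set -/

section Counting

theorem sum_powerset_insert_card {β M : Type*} [DecidableEq β] [AddCommMonoid M] {R : Finset β}
    {a : β} (ha : a ∉ R) (f : ℕ → M) :
    ∑ s ∈ (insert a R).powerset, f s.card = ∑ s ∈ R.powerset, (f s.card + f (s.card + 1)) := by
  rw [Finset.sum_powerset_insert ha, Finset.sum_add_distrib]
  congr 1
  exact Finset.sum_congr rfl fun s hs => by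
    rw [Finset.card_insert_of_notMem fun h => ha (Finset.mem_powerset.1 hs h)]

theorem sum_powerset_sq_sub_card {β : Type*} (R : Finset β) :
    ∑ s ∈ R.powerset, (2 * (s.card : ℝ) - R.card) ^ 2 = R.card * (2 : ℝ) ^ R.card := by
  classical
  induction R using Finset.induction_on with
  | empty => simp
  | insert a R ha ih =>
    rw [sum_powerset_insert_card ha fun m => (2 * (m : ℝ) - (insert a R).card) ^ 2,
      Finset.card_insert_of_notMem ha, Finset.sum_congr
        (g := fun s : Finset β => 2 * (2 * (s.card : ℝ) - R.card) ^ 2 + 2) rfl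
        fun s _ => by push_cast; ring, Finset.sum_add_distrib, ← Finset.mul_sum, ih]
    simp only [Finset.sum_const, Finset.card_powerset, nsmul_eq_mul]
    push_cast
    ring

/-- The summand is the fourth power of a sum of independent signs; adding an element replaces a
value `y` by `y + 1` and `y - 1`. The second moment would be too weak for the later union bound over
vertices. -/
theorem sum_powerset_pow_four_sub_card {β : Type*} (R : Finset β) :
    ∑ s ∈ R.powerset, (2 * (s.card : ℝ) - R.card) ^ 4 =
      (3 * (R.card : ℝ) ^ 2 - 2 * R.card) * 2 ^ R.card := by
  classical
  induction R using Finset.induction_on with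
  | empty => simp
  | insert a R ha ih =>
    rw [sum_powerset_insert_card ha fun m => (2 * (m : ℝ) - (insert a R).card) ^ 4,
      Finset.card_insert_of_notMem ha, Finset.sum_congr
        (g := fun s : Finset β => 2 * (2 * (s.card : ℝ) - R.card) ^ 4 +
          (12 * (2 * (s.card : ℝ) - R.card) ^ 2 + 2)) rfl
        fun s _ => by push_cast; ring, Finset.sum_add_distrib, ← Finset.mul_sum, ih,
      Finset.sum_add_distrib, ← Finset.mul_sum, sum_powerset_sq_sub_card]
    simp only [Finset.sum_const, Finset.card_powerset, nsmul_eq_mul]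
    push_cast
    ring

theorem card_filter_abs_sub_card_le {β : Type*} [Fintype β] {t : ℝ} (ht : 0 < t) :
    ((Finset.univ.filter fun s : Finset β => t ≤ |2 * (s.card : ℝ) - Fintype.card β|).card : ℝ) ≤
      3 * (Fintype.card β : ℝ) ^ 2 / t ^ 4 * Fintype.card (Finset β) := by
  have h := sum_powerset_pow_four_sub_card (Finset.univ : Finset β)
  rw [Finset.powerset_univ, Finset.card_univ] at h
  rw [div_mul_eq_mul_div, le_div_iff₀ (by positivity), Fintype.card_finset]
  calc _ = ∑ s ∈ Finset.univ.filter fun s : Finset β => t ≤ |2 * (s.card : ℝ) - Fintype.card β|,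
        t ^ 4 := by rw [Finset.sum_const, nsmul_eq_mul]
    _ ≤ ∑ s ∈ Finset.univ.filter fun s : Finset β => t ≤ |2 * (s.card : ℝ) - Fintype.card β|,
        (2 * (s.card : ℝ) - Fintype.card β) ^ 4 := by
      refine Finset.sum_le_sum fun s hs => ?_
      rw [← (show Even 4 by decide).pow_abs (2 * (s.card : ℝ) - Fintype.card β)]
      exact pow_le_pow_left₀ ht.le (Finset.mem_filter.1 hs).2 4
    _ ≤ ∑ s : Finset β, (2 * (s.card : ℝ) - Fintype.card β) ^ 4 :=
      Finset.sum_le_sum_of_subset_of_nonneg (Finset.filter_subset _ _) fun s _ _ => by positivity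
    _ ≤ _ := by
      rw [h]
      push_cast
      gcongr
      linarith [Nat.cast_nonneg (α := ℝ) (Fintype.card β)]

/-- Markov's inequality for the weight `2 ^ #{j | g j ≠ x}`: its total factors over the coordinates,
and it is at least `2 ^ (|β| - M)` on the functions counted. -/
theorem card_filter_rare_value_le {β κ : Type*} [Fintype β] [DecidableEq β] [Fintype κ]
    [DecidableEq κ] (x : κ) (M : ℕ) :
    (Finset.univ.filter fun g : β → κ =>
        (Finset.univ.filter fun j => g j = x).card ≤ M).card * 2 ^ Fintype.card β ≤
      (2 * Fintype.card κ - 1) ^ Fintype.card β * 2 ^ M := by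
  have h : ∑ g : β → κ, ∏ j, (if g j = x then 1 else 2) =
      (2 * Fintype.card κ - 1) ^ Fintype.card β := by
    have h1 : ∑ y : κ, (if y = x then 1 else 2) = 2 * Fintype.card κ - 1 := by
      have h2 : ∑ y : κ, ((if y = x then 1 else 2) + if y = x then 1 else 0) =
          2 * Fintype.card κ := by
        rw [Finset.sum_congr (g := fun _ => 2) rfl fun y _ => by split_ifs <;> rfl]
        simp [mul_comm]
      rw [Finset.sum_add_distrib] at h2
      simp only [Finset.sum_ite_eq', Finset.mem_univ, if_true] at h2
      omega
    rw [← h1, ← Finset.card_univ, ← Finset.prod_const, Finset.prod_univ_sum,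
      Fintype.piFinset_univ]
  rw [← h, Finset.sum_mul, Finset.card_eq_sum_ones, Finset.sum_mul]
  refine (Finset.sum_le_sum fun g hg => ?_).trans
    (Finset.sum_le_sum_of_subset (Finset.filter_subset _ _))
  have hg := (Finset.mem_filter.1 hg).2
  rw [Finset.prod_ite, Finset.prod_const_one, one_mul, Finset.prod_const, one_mul, ← pow_add]
  refine Nat.pow_le_pow_right (by norm_num) ?_
  have := Finset.card_filter_add_card_filter_not (s := (Finset.univ : Finset β)) fun j => g j = x
  rw [Finset.card_univ] at this
  omega

theorem Nat.centralBinom_sq_mul_le (j : ℕ) : j.centralBinom ^ 2 * (2 * j + 1) ≤ 16 ^ j := by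
  induction j with
  | zero => simp
  | succ j ih =>
    have h := Nat.succ_mul_centralBinom_succ j
    have h2 : (j + 1) ^ 2 * ((j + 1).centralBinom ^ 2 * (2 * (j + 1) + 1)) ≤
        (j + 1) ^ 2 * 16 ^ (j + 1) := by
      calc _ = ((j + 1) * (j + 1).centralBinom) ^ 2 * (2 * (j + 1) + 1) := by ring
        _ = (j.centralBinom ^ 2 * (2 * j + 1)) * (4 * ((2 * j + 1) * (2 * j + 3))) := by
          rw [h]; ring
        _ ≤ 16 ^ j * (16 * (j + 1) ^ 2) := Nat.mul_le_mul ih (by nlinarith)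
        _ = _ := by ring
    exact Nat.le_of_mul_le_mul_left h2 (by positivity)

/-- The size of a random set rarely belongs to a given small set of numbers. -/
theorem card_filter_card_mem_le (j b : ℕ) (F : Finset ℕ) :
    (Finset.univ.filter fun s : Finset (Fin (2 * j)) => b + s.card ∈ F).card ≤
      F.card * j.centralBinom := by
  have : (Finset.univ.filter fun s : Finset (Fin (2 * j)) => b + s.card ∈ F) ⊆
      F.biUnion fun d => Finset.powersetCard (d - b) Finset.univ := by
    intro s hs
    simp only [Finset.mem_biUnion, Finset.mem_powersetCard, Finset.subset_univ, true_and]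
    exact ⟨_, (Finset.mem_filter.1 hs).2, by omega⟩
  refine (Finset.card_le_card this).trans (Finset.card_biUnion_le_card_mul _ _ _ fun d _ => ?_)
  rw [Finset.card_powersetCard, Finset.card_univ, Fintype.card_fin]
  exact Nat.choose_le_centralBinom _ _

end Counting

/-! ### Concentration of degrees and sizes of joint neighborhoods -/

namespace SimpleGraph

section Degrees

variable {V α β : Type*} [Finite V] [Fintype β] {p : α → V} {q : β → V}

theorem ncard_neighborSet_resample (hp : Function.Injective p) (hq : Function.Injective q)
    (hpq : ∀ i j, p i ≠ q j) (G : SimpleGraph V) (η : α → Finset β) (i : α) :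
    ((G.resample p q η).neighborSet (p i)).ncard =
      {w | w ∉ Set.range q ∧ G.Adj (p i) w}.ncard + (η i).card := by
  have h1 : (G.resample p q η).neighborSet (p i) =
      {w | w ∉ Set.range q ∧ G.Adj (p i) w} ∪ q '' (η i) := by
    ext w
    by_cases hw : w ∈ Set.range q
    · obtain ⟨j, rfl⟩ := hw
      simp [resample_adj hp hq hpq, hq.eq_iff]
    · have h2 : w ∉ q '' (η i) := fun ⟨j, _, hj⟩ => hw ⟨j, hj⟩
      simp only [mem_neighborSet, Set.mem_union, h2, or_false, Set.mem_ofPred_eq, hw,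
        not_false_eq_true, true_and]
      refine resample_adj_of_notMem _ _ fun i' j => ⟨fun h => hw ⟨j, h.2.symm⟩, fun h => ?_⟩
      exact hpq _ _ h.1
  rw [h1, Set.ncard_union_eq _ (Set.toFinite _) (Set.toFinite _),
    Set.ncard_image_of_injective _ hq, Set.ncard_coe_finset]
  rw [Set.disjoint_left]
  rintro w ⟨hw, -⟩ ⟨j, _, hj⟩
  exact hw ⟨j, hj⟩

omit [Finite V] [Fintype β] in
theorem neighborSet_resample_of_notMem (G : SimpleGraph V) (η : α → Finset β) {w : V}
    (hp : ∀ i, w ≠ p i) (hq : ∀ j, w ≠ q j) :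
    (G.resample p q η).neighborSet w = G.neighborSet w := by
  ext x
  exact resample_adj_of_notMem _ _ fun i j => ⟨fun h => hp i h.1, fun h => hq j h.1⟩

end Degrees

variable {V : Type*} [Fintype V]

theorem density_abs_degree_sub_le (v : V) {t : ℝ} (ht : 0 < t) :
    density (fun G : SimpleGraph V =>
      t ≤ |2 * ((G.neighborSet v).ncard : ℝ) - (Fintype.card V - 1 : ℕ)|) ≤
      3 * (Fintype.card V : ℝ) ^ 2 / t ^ 4 := by
  classical
  let p : Unit → V := fun _ => v
  let q : {w // w ≠ v} → V := Subtype.val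
  have hp : Function.Injective p := fun _ _ _ => rfl
  have hq : Function.Injective q := Subtype.val_injective
  have hpq : ∀ i j, p i ≠ q j := fun i j h => j.2 h.symm
  have hc : Fintype.card {w // w ≠ v} = Fintype.card V - 1 := by simp
  refine (density_le_of_resample (Q := fun _ => True) hp hq hpq
    (c := 3 * (Fintype.card V : ℝ) ^ 2 / t ^ 4) (fun _ _ => trivial) (fun _ _ _ => trivial)
    fun G _ => ?_).trans (mul_le_of_le_one_right (by positivity) (density_le_one _))
  have hd : ∀ η, ((G.resample p q η).neighborSet v).ncard = (η ()).card := by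
    intro η
    have := ncard_neighborSet_resample hp hq hpq G η ()
    have h0 : {w | w ∉ Set.range q ∧ G.Adj (p ()) w} = ∅ := by
      ext w
      simp only [Set.mem_ofPred_eq, Set.mem_empty_iff_false, iff_false, not_and]
      intro hw h
      exact hw ⟨⟨w, h.ne'⟩, rfl⟩
    rwa [h0, Set.ncard_empty, zero_add] at this
  simp only [hd, ← hc]
  have h1 := card_filter_abs_sub_card_le (β := {w // w ≠ v}) ht
  have h2 : (Finset.univ.filter fun η : Unit → Finset {w // w ≠ v} =>
      t ≤ |2 * ((η ()).card : ℝ) - Fintype.card {w // w ≠ v}|).card =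
      (Finset.univ.filter fun s : Finset {w // w ≠ v} =>
        t ≤ |2 * (s.card : ℝ) - Fintype.card {w // w ≠ v}|).card := by
    refine Finset.card_bijective (fun η => η ()) (Equiv.funUnique Unit _).bijective fun η => ?_
    simp
  rw [ncard_eq_card_filter, h2, Nat.card_eq_fintype_card, Fintype.card_fun, Fintype.card_unit,
    pow_one]
  refine h1.trans ?_
  gcongr
  exact Fintype.card_subtype_le _

theorem density_card_common_le {u v : V} (huv : u ≠ v) (s t : Bool) (M : ℕ) :
    density (fun G : SimpleGraph V => {w | w ≠ u ∧ w ≠ v ∧ (G.Adj u w ↔ s = true) ∧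
      (G.Adj v w ↔ t = true)}.ncard ≤ M) ≤ (7 / 8) ^ (Fintype.card V - 2) * 2 ^ M := by
  classical
  let p : Bool → V := fun b => if b then u else v
  let q : {w // w ≠ u ∧ w ≠ v} → V := Subtype.val
  have hp : Function.Injective p := by
    intro a b; cases a <;> cases b <;> simp [p, huv, huv.symm]
  have hq : Function.Injective q := Subtype.val_injective
  have hpq : ∀ i j, p i ≠ q j := by
    rintro i j h
    cases i
    · exact j.2.2 h.symm
    · exact j.2.1 h.symm
  have hc : Fintype.card {w // w ≠ u ∧ w ≠ v} = Fintype.card V - 2 := by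
    rw [Fintype.card_subtype, ← Finset.card_pair huv, ← Finset.card_univ,
      ← Finset.card_sdiff_of_subset (Finset.subset_univ _)]
    congr 1
    ext w; simp
  rw [← hc]
  refine (density_le_of_resample (Q := fun _ => True) hp hq hpq
    (c := (7 / 8) ^ Fintype.card {w // w ≠ u ∧ w ≠ v} * 2 ^ M) (fun _ _ => trivial)
    (fun _ _ _ => trivial)
    fun G _ => ?_).trans (mul_le_of_le_one_right (by positivity) (density_le_one _))
  have hd : ∀ η, {w | w ≠ u ∧ w ≠ v ∧ ((G.resample p q η).Adj u w ↔ s = true) ∧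
      ((G.resample p q η).Adj v w ↔ t = true)}.ncard =
      (Finset.univ.filter fun j => (decide (j ∈ η true), decide (j ∈ η false)) = (s, t)).card := by
    intro η
    rw [← Set.ncard_coe_finset, ← Set.ncard_image_of_injective _ hq]
    congr 1
    have hu : ∀ j, (G.resample p q η).Adj u (q j) ↔ j ∈ η true := resample_adj hp hq hpq G η true
    have hv : ∀ j, (G.resample p q η).Adj v (q j) ↔ j ∈ η false :=
      resample_adj hp hq hpq G η false
    have hdec : ∀ (A : Prop) [Decidable A] (b : Bool), decide A = b ↔ (A ↔ b = true) := by
      intro A _ b; cases b <;> simp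
    ext w
    constructor
    · rintro ⟨h1, h2, h3⟩
      refine ⟨⟨w, h1, h2⟩, ?_, rfl⟩
      simpa [Prod.ext_iff, hdec, ← hu, ← hv] using h3
    · rintro ⟨j, h1, rfl⟩
      refine ⟨j.2.1, j.2.2, ?_⟩
      simpa [Prod.ext_iff, hdec, ← hu, ← hv] using h1
  simp only [hd]
  have h1 := card_filter_rare_value_le (β := {w // w ≠ u ∧ w ≠ v}) (s, t) M
  have h2 : (Finset.univ.filter fun η : Bool → Finset {w // w ≠ u ∧ w ≠ v} =>
      (Finset.univ.filter fun j =>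
        (decide (j ∈ η true), decide (j ∈ η false)) = (s, t)).card ≤ M).card ≤
      (Finset.univ.filter fun g : {w // w ≠ u ∧ w ≠ v} → Bool × Bool =>
        (Finset.univ.filter fun j => g j = (s, t)).card ≤ M).card := by
    refine Finset.card_le_card_of_injOn
      (fun η j => (decide (j ∈ η true), decide (j ∈ η false))) (fun η hη => by simpa using hη) ?_
    rintro η - η' - h
    funext b
    ext j
    have := congrFun h j
    simp only [Prod.mk.injEq, decide_eq_decide] at this
    cases b
    · exact this.2
    · exact this.1
  rw [ncard_eq_card_filter, Nat.card_eq_fintype_card, Fintype.card_fun, Fintype.card_bool,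
    Fintype.card_finset]
  generalize Fintype.card {w // w ≠ u ∧ w ≠ v} = N at *
  rw [show 2 * Fintype.card (Bool × Bool) - 1 = 7 from rfl] at h1
  have h3 := (Nat.mul_le_mul_right (2 ^ N) h2).trans h1
  refine le_of_mul_le_mul_right (a := (2 : ℝ) ^ N) ?_ (by positivity)
  calc _ ≤ (7 : ℝ) ^ N * 2 ^ M := by exact_mod_cast h3
    _ = _ := by
      rw [div_pow, show (8 : ℝ) = 2 ^ 3 by norm_num, ← pow_mul]
      push_cast
      field_simp
      ring

end SimpleGraph

/-! ### Separation by `C_1`, and alternating 4-cycles -/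

namespace SimpleGraph

variable {V : Type*}

theorem crColor_zero_eq_ncard [Fintype V] (G : SimpleGraph V) (x : V) :
    (G.crColor 0 x : ℕ) = (G.neighborSet x).ncard := by
  classical
  rw [crColor_zero, Set.ncard_eq_toFinset_card', ← card_neighborFinset_eq_degree]
  congr 1

/-- The multiset of the degrees of the vertices in `P`. -/
noncomputable def degrees (G : SimpleGraph V) (P : Finset V) : Multiset ℕ :=
  P.val.map fun w => (G.neighborSet w).ncard

theorem degrees_disjUnion (G : SimpleGraph V) {P Q : Finset V} (h : Disjoint P Q) :
    G.degrees (P.disjUnion Q h) = G.degrees P + G.degrees Q := by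
  simp [degrees]

open Classical in
theorem crColor_one_eq_degrees [Fintype V] (G : SimpleGraph V) (x : V) :
    G.crColor 1 x = G.degrees (G.neighborFinset x) := by
  rw [crColor_succ]
  exact Multiset.map_congr rfl fun w _ => crColor_zero_eq_ncard G w

theorem degrees_congr {G H : SimpleGraph V} {P : Finset V}
    (h : ∀ w ∈ P, G.neighborSet w = H.neighborSet w) : G.degrees P = H.degrees P :=
  Multiset.map_congr rfl fun w hw => by rw [h w hw]

/-- For `X ⊆ P \ Q`, agreement of the degrees in `P` and `Q` determines the degrees in `X` from the
degrees outside of `X`. -/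
theorem degrees_eq_sub [DecidableEq V] {G : SimpleGraph V} {P Q X : Finset V} (hXP : X ⊆ P)
    (hXQ : Disjoint X Q) (h : G.degrees P = G.degrees Q) :
    G.degrees X = G.degrees (Q \ P) - G.degrees ((P \ Q) \ X) := by
  have hd : ∀ w ∈ X, w ∉ Q := fun w hw => Finset.disjoint_left.1 hXQ hw
  have h1 : G.degrees P = G.degrees (P ∩ Q) + (G.degrees X + G.degrees ((P \ Q) \ X)) := by
    rw [← degrees_disjUnion _ Finset.disjoint_sdiff,
      ← degrees_disjUnion _ (Finset.disjoint_left.2 fun x h1 h2 => ?_)]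
    · congr 1
      ext w
      have := @hXP w
      have := hd w
      simp only [Finset.disjUnion_eq_union, Finset.mem_union, Finset.mem_inter, Finset.mem_sdiff]
      tauto
    · simp only [Finset.disjUnion_eq_union, Finset.mem_union, Finset.mem_inter,
        Finset.mem_sdiff] at h1 h2
      have := hd x
      tauto
  have h2 : G.degrees Q = G.degrees (P ∩ Q) + G.degrees (Q \ P) := by
    rw [← degrees_disjUnion _ (Finset.disjoint_left.2 fun x h1 h2 => ?_)]
    · congr 1
      ext w
      simp only [Finset.disjUnion_eq_union, Finset.mem_union, Finset.mem_inter, Finset.mem_sdiff]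
      tauto
    · simp only [Finset.mem_inter, Finset.mem_sdiff] at h1 h2
      tauto
  rw [h1, h2, add_right_inj] at h
  rw [← h, add_tsub_cancel_right]

variable [Fintype V]

/-- Condition on both neighborhoods and resample between six private neighbors `X` of `u` and `2 *
j` common neighbors `Z`. Equality of colors pins the degrees in `X` to a fixed multiset `T`; each is
hit with probability at most `6 / √(2j + 1)`, independently over `X`. Six vertices give the exponent
3. -/
theorem density_crColor_one_eq_le {u v : V} (j : ℕ) :
    density (fun G : SimpleGraph V => G.crColor 1 u = G.crColor 1 v ∧
      6 ≤ {w | w ≠ v ∧ G.Adj u w ∧ ¬ G.Adj v w}.ncard ∧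
      2 * j ≤ {w | G.Adj u w ∧ G.Adj v w}.ncard) ≤ 6 ^ 6 / (2 * j + 1 : ℝ) ^ 3 := by
  classical
  refine density_le_of_fiberwise (fun G => (G.neighborFinset u, G.neighborFinset v)) _ fun k => ?_
  obtain ⟨P, Q⟩ := k
  -- A witness `G₀` is needed to know that `P` and `Q` leave room for `X` and `Z`; without one the
  -- bound is trivial.
  by_cases hne : ∃ G : SimpleGraph V, ((G.neighborFinset u, G.neighborFinset v) = (P, Q) ∧
      G.crColor 1 u = G.crColor 1 v ∧
      6 ≤ {w | w ≠ v ∧ G.Adj u w ∧ ¬ G.Adj v w}.ncard ∧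
      2 * j ≤ {w | G.Adj u w ∧ G.Adj v w}.ncard)
  swap
  · refine le_trans (le_of_eq ?_) (mul_nonneg (by positivity) (density_nonneg _))
    rw [density_eq, Finset.filter_false_of_mem fun G _ hG => hne ⟨G, hG⟩]
    simp
  obtain ⟨G₀, h0, -, h6, h2j⟩ := hne
  obtain ⟨rfl, rfl⟩ := Prod.mk.inj h0
  have hX : 6 ≤ (((G₀.neighborFinset u \ G₀.neighborFinset v).erase v)).card := by
    refine h6.trans_eq ?_
    rw [ncard_eq_card_filter]
    congr 1
    ext w; simp
  have hZ : 2 * j ≤ (G₀.neighborFinset u ∩ G₀.neighborFinset v).card := by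
    refine h2j.trans_eq ?_
    rw [ncard_eq_card_filter]
    congr 1
    ext w; simp
  obtain ⟨X, hX, hXc⟩ := Finset.exists_subset_card_eq hX
  obtain ⟨Z, hZ, hZc⟩ := Finset.exists_subset_card_eq hZ
  let p : Fin 6 → V := fun i => ((Finset.equivFinOfCardEq hXc).symm i : V)
  let q : Fin (2 * j) → V := fun i => ((Finset.equivFinOfCardEq hZc).symm i : V)
  have hp : Function.Injective p := Subtype.val_injective.comp (Equiv.injective _)
  have hq : Function.Injective q := Subtype.val_injective.comp (Equiv.injective _)
  have hpX : ∀ i, p i ∈ X := fun i => Subtype.prop _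
  have hqZ : ∀ i, q i ∈ Z := fun i => Subtype.prop _
  have hXp : ∀ w ∈ X, ∃ i, w = p i := fun w hw =>
    ⟨Finset.equivFinOfCardEq hXc ⟨w, hw⟩, by simp [p]⟩
  set P := G₀.neighborFinset u with hP
  set Q := G₀.neighborFinset v with hQ
  have hX' : ∀ w ∈ X, w ≠ v ∧ w ∈ P ∧ w ∉ Q := fun w hw => by simpa using hX hw
  have hZ' : ∀ w ∈ Z, w ∈ P ∧ w ∈ Q := fun w hw => by simpa using hZ hw
  have huP : u ∉ P := by simp [hP]
  have hvQ : v ∉ Q := by simp [hQ]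
  have hpq : ∀ i j, p i ≠ q j := fun i j h =>
    (hX' _ (hpX i)).2.2 (h ▸ (hZ' _ (hqZ j)).2)
  have hfix : ∀ (G : SimpleGraph V) η,
      ((G.resample p q η).neighborFinset u, (G.resample p q η).neighborFinset v) =
        (G.neighborFinset u, G.neighborFinset v) := by
    intro G η
    simp only [Prod.mk.injEq, ← Finset.coe_inj, coe_neighborFinset]
    refine ⟨neighborSet_resample_of_notMem _ _ ?_ ?_, neighborSet_resample_of_notMem _ _ ?_ ?_⟩
    · exact fun i h => huP (h ▸ (hX' _ (hpX i)).2.1)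
    · exact fun i h => huP (h ▸ (hZ' _ (hqZ i)).1)
    · exact fun i h => (hX' _ (hpX i)).1 h.symm
    · exact fun i h => hvQ (h ▸ (hZ' _ (hqZ i)).2)
  refine density_le_of_resample hp hq hpq (fun G hG => hG.1) (fun G η hG => (hfix G η).trans hG)
    fun G hG => ?_
  set T : Multiset ℕ := G.degrees (Q \ P) - G.degrees ((P \ Q) \ X) with hT
  have hforce : ∀ η, (G.resample p q η).crColor 1 u = (G.resample p q η).crColor 1 v →
      (G.resample p q η).degrees X = T := by
    intro η hη
    obtain ⟨h1, h2⟩ := Prod.mk.inj ((hfix G η).trans hG)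
    rw [crColor_one_eq_degrees, crColor_one_eq_degrees, h1, h2] at hη
    rw [degrees_eq_sub (fun w hw => (hX' w hw).2.1)
      (Finset.disjoint_left.2 fun w hw => (hX' w hw).2.2) hη, hT]
    congr 1
    · refine degrees_congr fun w hw => neighborSet_resample_of_notMem _ _ (fun i h => ?_)
        fun i h => ?_
      · exact (hX' _ (hpX i)).2.2 (h ▸ (Finset.mem_sdiff.1 hw).1)
      · exact (Finset.mem_sdiff.1 hw).2 (h ▸ (hZ' _ (hqZ i)).1)
    · refine degrees_congr fun w hw => neighborSet_resample_of_notMem _ _ (fun i h => ?_)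
        fun i h => ?_
      · exact (Finset.mem_sdiff.1 hw).2 (h ▸ hpX i)
      · exact (Finset.mem_sdiff.1 (Finset.mem_sdiff.1 hw).1).2 (h ▸ (hZ' _ (hqZ i)).2)
  -- `T` is a truncated difference of multisets, so its size is bounded only once some `η₀` realizes
  -- it as the degrees of the six vertices of `X`.
  rcases Set.eq_empty_or_nonempty {η : Fin 6 → Finset (Fin (2 * j)) |
      ((G.resample p q η).neighborFinset u, (G.resample p q η).neighborFinset v) = (P, Q) ∧
      (G.resample p q η).crColor 1 u = (G.resample p q η).crColor 1 v ∧
      6 ≤ {w | w ≠ v ∧ (G.resample p q η).Adj u w ∧ ¬ (G.resample p q η).Adj v w}.ncard ∧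
      2 * j ≤ {w | (G.resample p q η).Adj u w ∧ (G.resample p q η).Adj v w}.ncard} with he | he
  · rw [he, Set.ncard_empty, Nat.cast_zero]
    positivity
  obtain ⟨η₀, -, hη₀, -⟩ := he
  have hTc : T.toFinset.card ≤ 6 := by
    refine (Multiset.toFinset_card_le _).trans ?_
    rw [← hforce _ hη₀, degrees, Multiset.card_map, Finset.card_val, hXc]
  let b : Fin 6 → ℕ := fun i => {w | w ∉ Set.range q ∧ G.Adj (p i) w}.ncard
  have hsub : {η : Fin 6 → Finset (Fin (2 * j)) |
      ((G.resample p q η).neighborFinset u, (G.resample p q η).neighborFinset v) = (P, Q) ∧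
      (G.resample p q η).crColor 1 u = (G.resample p q η).crColor 1 v ∧
      6 ≤ {w | w ≠ v ∧ (G.resample p q η).Adj u w ∧ ¬ (G.resample p q η).Adj v w}.ncard ∧
      2 * j ≤ {w | (G.resample p q η).Adj u w ∧ (G.resample p q η).Adj v w}.ncard} ⊆
      (Fintype.piFinset fun i => Finset.univ.filter fun s => b i + s.card ∈ T.toFinset :
        Finset (Fin 6 → Finset (Fin (2 * j)))) := by
    rintro η ⟨-, hη, -⟩
    simp only [Finset.mem_coe, Fintype.mem_piFinset, Finset.mem_filter, Finset.mem_univ, true_and,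
      Multiset.mem_toFinset]
    intro i
    rw [← hforce η hη, ← ncard_neighborSet_resample hp hq hpq G η i]
    exact Multiset.mem_map_of_mem _ (hpX i)
  have hcard := Set.ncard_le_ncard hsub (Set.toFinite _)
  rw [Set.ncard_coe_finset, Fintype.card_piFinset] at hcard
  have hcard' := hcard.trans (Finset.prod_le_prod' fun i _ =>
    (card_filter_card_mem_le j (b i) T.toFinset).trans (Nat.mul_le_mul_right _ hTc))
  rw [Finset.prod_const, Finset.card_univ, Fintype.card_fin] at hcard'
  rw [div_mul_eq_mul_div, le_div_iff₀ (by positivity), Nat.card_eq_fintype_card, Fintype.card_fun,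
    Fintype.card_finset, Fintype.card_fin, Fintype.card_fin]
  have h3 := Nat.mul_le_mul_right ((2 * j + 1) ^ 3) hcard'
  have h4 : (6 * j.centralBinom) ^ 6 * (2 * j + 1) ^ 3 ≤ 6 ^ 6 * (2 ^ (2 * j)) ^ 6 := by
    calc _ = 6 ^ 6 * (j.centralBinom ^ 2 * (2 * j + 1)) ^ 3 := by ring
      _ ≤ 6 ^ 6 * (16 ^ j) ^ 3 := by gcongr; exact Nat.centralBinom_sq_mul_le j
      _ = _ := by
        rw [show 16 = 2 ^ 4 by norm_num, ← pow_mul, ← pow_mul, ← pow_mul]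
        ring_nf
  exact_mod_cast h3.trans h4

/-- With high probability, two given families of pairs contain an alternating cycle. -/
theorem density_no_alternating_le {k : ℕ} {p q : Fin k × Bool → V} (hp : Function.Injective p)
    (hq : Function.Injective q) (hpq : ∀ i j, p i ≠ q j) :
    density (fun G : SimpleGraph V => ∀ i j, ¬ ∀ s t, G.Adj (p (i, s)) (q (j, t)) ↔ s = t) ≤
      (15 / 16) ^ k ^ 2 := by
  classical
  refine (density_le_of_resample (Q := fun _ => True) hp hq hpq (c := (15 / 16) ^ k ^ 2)
    (fun _ _ => trivial) (fun _ _ _ => trivial)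
    fun G _ => ?_).trans (mul_le_of_le_one_right (by positivity) (density_le_one _))
  simp only [resample_adj hp hq hpq]
  -- The edges split into `k ^ 2` disjoint 2 by 2 blocks, each of which must avoid one of its 16
  -- patterns.
  have h1 : {η : Fin k × Bool → Finset (Fin k × Bool) |
      ∀ i j, ¬ ∀ s t, (j, t) ∈ η (i, s) ↔ s = t}.ncard ≤
      (Fintype.piFinset fun _ => {fun x => x.1 == x.2}ᶜ :
        Finset (Fin k × Fin k → Bool × Bool → Bool)).card := by
    rw [← Set.ncard_coe_finset]
    refine Set.ncard_le_ncard_of_injOn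
      (fun η ij st => decide ((ij.2, st.2) ∈ η (ij.1, st.1))) ?_ ?_ (Set.toFinite _)
    · intro η hη
      simp only [Finset.mem_coe, Fintype.mem_piFinset, Finset.mem_compl, Finset.mem_singleton]
      intro ij h
      refine hη ij.1 ij.2 fun s t => ?_
      have := congrFun h (s, t)
      rw [Bool.eq_iff_iff] at this
      simpa using this
    · rintro η - η' - h
      funext ⟨i, s⟩
      ext ⟨j, t⟩
      simpa using congrFun (congrFun h (i, j)) (s, t)
  rw [Fintype.card_piFinset, Finset.prod_const, Finset.card_compl, Finset.card_singleton,
    Finset.card_univ] at h1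
  have h2 : Fintype.card (Bool × Bool → Bool) - 1 = 15 := rfl
  rw [h2, Fintype.card_prod, Fintype.card_fin] at h1
  rw [Nat.card_eq_fintype_card, Fintype.card_fun, Fintype.card_finset, Fintype.card_prod,
    Fintype.card_fin, Fintype.card_bool]
  calc _ ≤ ((15 ^ (k * k) : ℕ) : ℝ) := by exact_mod_cast h1
    _ = _ := by
      push_cast
      rw [div_pow, ← pow_mul, sq, show k * 2 * (k * 2) = 4 * (k * k) by ring, pow_mul (2 : ℝ) 4,
        show (2 : ℝ) ^ 4 = 16 by norm_num, div_mul_cancel₀ _ (by positivity)]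

theorem density_exists_no_alternating_le (k : ℕ) :
    density (fun G : SimpleGraph V => ∃ f : (Fin k × Bool) ⊕ (Fin k × Bool) ↪ V, ∀ i j,
      ¬ ∀ s t, G.Adj (f (.inl (i, s))) (f (.inr (j, t))) ↔ s = t) ≤
      (Fintype.card V : ℝ) ^ (4 * k) * (15 / 16) ^ k ^ 2 := by
  classical
  have h (f : (Fin k × Bool) ⊕ (Fin k × Bool) ↪ V) := density_no_alternating_le
    (p := fun x => f (.inl x)) (q := fun x => f (.inr x))
    (fun a b h => Sum.inl_injective (f.injective h))
    (fun a b h => Sum.inr_injective (f.injective h))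
    (fun i j h => Sum.inl_ne_inr (f.injective h))
  refine (density_exists_le_mul _ h).trans ?_
  gcongr
  rw [← Nat.cast_pow, Nat.cast_le]
  refine (Fintype.card_le_of_injective _ DFunLike.coe_injective).trans_eq ?_
  simp only [Fintype.card_fun, Fintype.card_sum, Fintype.card_prod, Fintype.card_fin,
    Fintype.card_bool]
  congr 1
  ring

end SimpleGraph

/-! ### Typical graphs -/

namespace SimpleGraph

variable {V : Type*}

theorem density_false : density (fun _ : SimpleGraph V => False) = 0 := by
  simp [density]

variable [Fintype V]

/-- The vertex `u` only serves to exhibit more than `M` non-neighbors of `x`. Their degrees take at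
most `τ + 2` values, so some `4 * k` of them share a degree, and `halt` finds the cycle there. -/
theorem exists_not_iso_of_typical {G : SimpleGraph V} {M k τ : ℕ} (hV : 1 < Fintype.card V)
    (hcol : Function.Injective (G.crColor 1))
    (hpair : ∀ u v, u ≠ v → M < {w | w ≠ v ∧ G.Adj u w ∧ ¬ G.Adj v w}.ncard)
    (hdeg : ∀ v, |2 * ((G.neighborSet v).ncard : ℝ) - (Fintype.card V - 1 : ℕ)| < τ)
    (halt : ∀ f : (Fin k × Bool) ⊕ (Fin k × Bool) ↪ V, ∃ i j,
      ∀ s t, G.Adj (f (.inl (i, s))) (f (.inr (j, t))) ↔ s = t)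
    (hM : (τ + 2) * (4 * k) ≤ M) :
    ∃ H : SimpleGraph V, ¬ Nonempty (G ≃g H) ∧ G.crColorSet 3 ∩ H.crColorSet 3 ≠ ∅ := by
  classical
  have : Nontrivial V := Fintype.one_lt_card_iff_nontrivial.1 hV
  obtain ⟨u, x, hux⟩ := exists_pair_ne V
  set B : Finset V := Finset.univ.filter fun w => w ≠ x ∧ G.Adj u w ∧ ¬ G.Adj x w with hB
  have hBM : M < B.card := by
    rw [hB, ← ncard_eq_card_filter]
    exact hpair u x hux
  have hmaps : ∀ w ∈ B, (G.neighborSet w).ncard ∈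
      Finset.Icc ((Fintype.card V - 1 - τ) / 2) ((Fintype.card V - 1 + τ) / 2) := by
    intro w _
    have h := abs_lt.1 (hdeg w)
    have h1 : Fintype.card V - 1 < 2 * (G.neighborSet w).ncard + τ := by
      have : ((Fintype.card V - 1 : ℕ) : ℝ) < 2 * (G.neighborSet w).ncard + τ := by linarith [h.1]
      exact_mod_cast this
    have h2 : 2 * (G.neighborSet w).ncard < Fintype.card V - 1 + τ := by
      have : 2 * ((G.neighborSet w).ncard : ℝ) < (Fintype.card V - 1 : ℕ) + τ := by linarith [h.2]
      exact_mod_cast this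
    rw [Finset.mem_Icc]
    omega
  have hIcc : (Finset.Icc ((Fintype.card V - 1 - τ) / 2) ((Fintype.card V - 1 + τ) / 2)).card ≤
      τ + 2 := by
    rw [Nat.card_Icc]
    omega
  obtain ⟨d, -, hd⟩ := Finset.exists_lt_card_fiber_of_mul_lt_card_of_maps_to (n := 4 * k) hmaps
    (((Nat.mul_le_mul_right _ hIcc).trans hM).trans_lt hBM)
  have hcard : Fintype.card ((Fin k × Bool) ⊕ (Fin k × Bool)) ≤
      Fintype.card {w // w ∈ B.filter fun w => (G.neighborSet w).ncard = d} := by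
    rw [Fintype.card_coe]
    refine le_trans (le_of_eq ?_) hd.le
    simp only [Fintype.card_sum, Fintype.card_prod, Fintype.card_fin, Fintype.card_bool]
    ring
  obtain ⟨f⟩ := Function.Embedding.nonempty_of_card_le hcard
  have hf : ∀ i, (f i : V) ≠ x ∧ ¬ G.Adj x (f i) ∧ (G.neighborSet (f i)).ncard = d := by
    intro i
    have := (f i).2
    simp only [Finset.mem_filter, hB, Finset.mem_univ, true_and] at this
    tauto
  have hcol0 : ∀ i i', G.crColor 0 (f i) = G.crColor 0 (f i') := fun i i' =>
    (crColor_zero_eq_ncard G _).trans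
      (((hf i).2.2.trans (hf i').2.2.symm).trans (crColor_zero_eq_ncard G _).symm)
  have hne : ∀ i i', i ≠ i' → (f i : V) ≠ f i' := fun i i' h h' =>
    h (f.injective (Subtype.val_injective h'))
  obtain ⟨i, j, hij⟩ := halt (f.trans (Function.Embedding.subtype _))
  simp only [Function.Embedding.trans_apply, Function.Embedding.subtype_apply] at hij
  refine exists_switch (a := f (.inl (i, true))) (b := f (.inr (j, true)))
    (c := f (.inl (i, false))) (d := f (.inr (j, false))) (x := x) hcol
    ((hij _ _).2 rfl) ((hij _ _).2 rfl) (fun h => ?_) (fun h => ?_) (hne _ _ (by simp))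
    (hne _ _ (by simp)) (hcol0 _ _) (hcol0 _ _) ?_
  · exact absurd ((hij _ _).1 h) (by simp)
  · exact absurd ((hij _ _).1 h) (by simp)
  · rintro y (rfl | rfl | rfl | rfl) <;> exact ⟨(hf _).1, (hf _).2.1⟩

theorem crColorSet_of_typical {G : SimpleGraph V} {M k τ : ℕ} (hV : 1 < Fintype.card V)
    (hcol : Function.Injective (G.crColor 1))
    (hpair : ∀ u v, u ≠ v → M < {w | w ≠ v ∧ G.Adj u w ∧ ¬ G.Adj v w}.ncard)
    (hcommon : ∀ u v, u ≠ v → {w | G.Adj u w ∧ G.Adj v w}.Nonempty)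
    (hdeg : ∀ v, |2 * ((G.neighborSet v).ncard : ℝ) - (Fintype.card V - 1 : ℕ)| < τ)
    (halt : ∀ f : (Fin k × Bool) ⊕ (Fin k × Bool) ↪ V, ∃ i j,
      ∀ s t, G.Adj (f (.inl (i, s))) (f (.inr (j, t))) ↔ s = t)
    (hM : (τ + 2) * (4 * k) ≤ M) :
    (∀ H : SimpleGraph V, ¬ Nonempty (G ≃g H) → G.crColorSet 4 ∩ H.crColorSet 4 = ∅) ∧
    (∃ H : SimpleGraph V, ¬ Nonempty (G ≃g H) ∧ G.crColorSet 3 ∩ H.crColorSet 3 ≠ ∅) ∧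
    (∀ H : SimpleGraph V, ¬ Nonempty (G ≃g H) → G.crColorSet 2 ≠ H.crColorSet 2) := by
  have : Nontrivial V := Fintype.one_lt_card_iff_nontrivial.1 hV
  refine ⟨fun H hH => crColorSet_inter_eq_empty hcol (fun x w => ?_) hH,
    exists_not_iso_of_typical hV hcol hpair hdeg halt hM,
    fun H hH h => hH (nonempty_iso_of_crColorSet_subset hcol h.subset)⟩
  rcases eq_or_ne x w with rfl | hxw
  · obtain ⟨v, hv⟩ := exists_ne x
    obtain ⟨y, hy, -⟩ := hcommon x v hv.symm
    exact ⟨y, hy, hy.symm⟩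
  · obtain ⟨y, hy, hy'⟩ := hcommon x w hxw
    exact ⟨y, hy, hy'.symm⟩

/-- A quantitative bound for the proportion of graphs without the desired properties. -/
theorem density_not_typical_le {M k τ : ℕ} (hV : 8 * M + 2 ≤ Fintype.card V)
    (hM6 : 6 ≤ M) (hτ : 0 < τ) (hM : (τ + 2) * (4 * k) ≤ M) :
    density (fun G : SimpleGraph V => ¬
      ((∀ H : SimpleGraph V, ¬ Nonempty (G ≃g H) → G.crColorSet 4 ∩ H.crColorSet 4 = ∅) ∧
      (∃ H : SimpleGraph V, ¬ Nonempty (G ≃g H) ∧ G.crColorSet 3 ∩ H.crColorSet 3 ≠ ∅) ∧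
      (∀ H : SimpleGraph V, ¬ Nonempty (G ≃g H) → G.crColorSet 2 ≠ H.crColorSet 2))) ≤
    2 * (Fintype.card V : ℝ) ^ 2 * (7 / 10) ^ M + (Fintype.card V : ℝ) ^ 2 * (6 ^ 6 / (M : ℝ) ^ 3) +
    3 * (Fintype.card V : ℝ) ^ 3 / τ ^ 4 +
    (Fintype.card V : ℝ) ^ (4 * k) * (15 / 16) ^ k ^ 2 := by
  classical
  -- The Boolean treats private neighbors (`false`) and common neighbors (`true`) together. The base
  -- `7 / 10` bounds `(7 / 8) ^ 8 * 2`.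
  have h1 := density_exists_le_mul (V := V) (ι := V × V × Bool)
    (fun x G => x.1 ≠ x.2.1 ∧ {w | w ≠ x.1 ∧ w ≠ x.2.1 ∧ (G.Adj x.1 w ↔ true = true) ∧
      (G.Adj x.2.1 w ↔ x.2.2 = true)}.ncard ≤ M) (c := (7 / 10) ^ M) <| by
    rintro ⟨u, v, b⟩
    by_cases huv : u = v
    · simp only [huv, ne_eq, not_true_eq_false, false_and]
      rw [density_false]
      positivity
    · refine (density_mono fun G hG => hG.2).trans
        ((density_card_common_le huv true b M).trans ?_)
      calc ((7 : ℝ) / 8) ^ (Fintype.card V - 2) * 2 ^ M ≤ (7 / 8) ^ (8 * M) * 2 ^ M := by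
            gcongr ?_ * _
            exact pow_le_pow_of_le_one (by norm_num) (by norm_num) (by omega)
        _ = ((7 / 8) ^ 8 * 2) ^ M := by rw [mul_pow, pow_mul]
        _ ≤ _ := by gcongr; norm_num
  have h2 := density_exists_le_mul (V := V) (ι := V × V)
    (fun x G => G.crColor 1 x.1 = G.crColor 1 x.2 ∧
      6 ≤ {w | w ≠ x.2 ∧ G.Adj x.1 w ∧ ¬ G.Adj x.2 w}.ncard ∧
      2 * (M / 2) ≤ {w | G.Adj x.1 w ∧ G.Adj x.2 w}.ncard) (c := 6 ^ 6 / (M : ℝ) ^ 3) <| by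
    rintro ⟨u, v⟩
    refine (density_crColor_one_eq_le (M / 2)).trans ?_
    have : (M : ℝ) ≤ 2 * (M / 2 : ℕ) + 1 := by
      exact_mod_cast (show M ≤ 2 * (M / 2) + 1 by omega)
    gcongr
  have h3 := density_exists_le_mul (V := V) (ι := V) _ fun v =>
    density_abs_degree_sub_le v (t := τ) (by exact_mod_cast hτ)
  have h4 := density_exists_no_alternating_le (V := V) k
  have hsum := add_le_add (add_le_add (add_le_add h1 h2) h3) h4
  refine le_trans ?_ (hsum.trans (le_of_eq ?_))
  · refine le_trans (density_mono fun G hG => ?_) ((density_or_le _ _).trans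
      (add_le_add ((density_or_le _ _).trans (add_le_add (density_or_le _ _) le_rfl)) le_rfl))
    by_contra hcon
    push Not at hcon
    obtain ⟨⟨⟨c1, c2⟩, c3⟩, c4⟩ := hcon
    have hpair : ∀ u v, u ≠ v → M < {w | w ≠ v ∧ G.Adj u w ∧ ¬ G.Adj v w}.ncard :=
      fun u v huv => (c1 (u, v, false) huv).trans_le <| Set.ncard_le_ncard (fun w hw => by
        simpa using hw.2) (Set.toFinite _)
    have hcommon : ∀ u v, u ≠ v → M < {w | G.Adj u w ∧ G.Adj v w}.ncard :=
      fun u v huv => (c1 (u, v, true) huv).trans_le <| Set.ncard_le_ncard (fun w hw => by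
        simpa using hw.2.2) (Set.toFinite _)
    refine hG (crColorSet_of_typical (by omega) (fun u v huv => ?_) hpair
      (fun u v huv => Set.nonempty_of_ncard_ne_zero (by have := hcommon u v huv; omega)) c3 c4 hM)
    by_contra hne
    have := c2 (u, v) huv (hM6.trans (hpair u v hne).le)
    have := hcommon u v hne
    simp only at *
    omega
  · simp only [Fintype.card_prod, Fintype.card_bool]
    push_cast
    ring

end SimpleGraph

/-! ### Asymptotics of the failure bound -/

theorem tendsto_nthRoot_atTop {r : ℕ} (hr : r ≠ 0) : Tendsto (Nat.nthRoot r) atTop atTop :=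
  tendsto_atTop.2 fun b => (eventually_ge_atTop (b ^ r)).mono fun _ ha =>
    (Nat.le_nthRoot_iff hr).2 ha

theorem tendsto_two_mul_pow_mul_pow_pow :
    Tendsto (fun m : ℕ => ((2 * m : ℝ) ^ 40 * (15 / 16) ^ m) ^ m) atTop (𝓝 0) := by
  have h : Tendsto (fun m : ℕ => (2 : ℝ) ^ 40 * ((m : ℝ) ^ 40 * (15 / 16) ^ m)) atTop (𝓝 0) := by
    simpa using (tendsto_pow_const_mul_const_pow_of_lt_one 40 (r := (15 / 16 : ℝ)) (by norm_num)
      (by norm_num)).const_mul ((2 : ℝ) ^ 40)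
  refine squeeze_zero' (Eventually.of_forall fun m => by positivity)
    ((h.eventually_le_const (show (0 : ℝ) < 1 / 2 by norm_num)).mono fun m hm => ?_)
    (tendsto_pow_atTop_nhds_zero_of_lt_one (r := (1 / 2 : ℝ)) (by norm_num) (by norm_num))
  gcongr
  rwa [mul_pow, mul_assoc]

/-- With `m ≈ n ^ (1/10)`, the choices are `k = m`, `τ = m ^ 8` and `M ≈ n / 8`. The third term is
then of order `m ^ 30 / m ^ 32`; in the last, `m ^ (40 m)` loses to `(16 / 15) ^ (m ^ 2)`. Meanwhile
`τ * k` has order `m ^ 9`, well below `M`. -/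
theorem tendsto_failure_bound :
    Tendsto (fun n : ℕ => 2 * (n : ℝ) ^ 2 * (7 / 10) ^ ((n - 2) / 8) +
      (n : ℝ) ^ 2 * (6 ^ 6 / (((n - 2) / 8 : ℕ) : ℝ) ^ 3) +
      3 * (n : ℝ) ^ 3 / ((Nat.nthRoot 10 n ^ 8 : ℕ) : ℝ) ^ 4 +
      (n : ℝ) ^ (4 * Nat.nthRoot 10 n) * (15 / 16) ^ Nat.nthRoot 10 n ^ 2) atTop (𝓝 0) := by
  have hM : Tendsto (fun n : ℕ => (n - 2) / 8) atTop atTop :=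
    tendsto_atTop.2 fun b => (eventually_ge_atTop (8 * b + 2)).mono fun n hn => by omega
  have hm : Tendsto (fun n : ℕ => Nat.nthRoot 10 n) atTop atTop :=
    tendsto_nthRoot_atTop (by norm_num)
  have hnM : ∀ᶠ n : ℕ in atTop, 0 < (((n - 2) / 8 : ℕ) : ℝ) ∧
      (n : ℝ) ≤ 17 * (((n - 2) / 8 : ℕ) : ℝ) := by
    filter_upwards [hM.eventually_ge_atTop 1] with n hn
    exact ⟨by exact_mod_cast hn, by exact_mod_cast (show n ≤ 17 * ((n - 2) / 8) by omega)⟩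
  have hnm : ∀ᶠ n : ℕ in atTop, 0 < (Nat.nthRoot 10 n : ℝ) ∧
      (n : ℝ) ≤ (2 * (Nat.nthRoot 10 n : ℝ)) ^ 10 := by
    filter_upwards [hm.eventually_ge_atTop 1] with n hn
    refine ⟨by exact_mod_cast hn, ?_⟩
    have h1 := (Nat.lt_pow_nthRoot_add_one (n := 10) (by norm_num) n).le
    exact_mod_cast h1.trans (Nat.pow_le_pow_left (by omega) 10)
  rw [show (0 : ℝ) = 0 + 0 + 0 + 0 by norm_num]
  refine ((Tendsto.add ?_ ?_).add ?_).add ?_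
  · have h : Tendsto (fun M : ℕ => 578 * ((M : ℝ) ^ 2 * (7 / 10) ^ M)) atTop (𝓝 0) := by
      simpa using (tendsto_pow_const_mul_const_pow_of_lt_one 2 (r := (7 / 10 : ℝ)) (by norm_num)
        (by norm_num)).const_mul (578 : ℝ)
    refine squeeze_zero' (Eventually.of_forall fun n => by positivity) ?_ (h.comp hM)
    filter_upwards [hnM] with n ⟨h0, hn⟩
    calc 2 * (n : ℝ) ^ 2 * (7 / 10) ^ ((n - 2) / 8)
        ≤ 2 * (17 * (((n - 2) / 8 : ℕ) : ℝ)) ^ 2 * (7 / 10) ^ ((n - 2) / 8) := by gcongr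
      _ = _ := by simp only [Function.comp]; ring
  · have h : Tendsto (fun M : ℕ => (289 * 6 ^ 6 : ℝ) / M) atTop (𝓝 0) :=
      tendsto_const_div_atTop_nhds_zero_nat _
    refine squeeze_zero' (Eventually.of_forall fun n => by positivity) ?_ (h.comp hM)
    filter_upwards [hnM] with n ⟨h0, hn⟩
    calc (n : ℝ) ^ 2 * (6 ^ 6 / (((n - 2) / 8 : ℕ) : ℝ) ^ 3)
        ≤ (17 * (((n - 2) / 8 : ℕ) : ℝ)) ^ 2 * (6 ^ 6 / (((n - 2) / 8 : ℕ) : ℝ) ^ 3) := by gcongr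
      _ = _ := by simp only [Function.comp]; field_simp; ring
  · have h : Tendsto (fun m : ℕ => (3 * 2 ^ 30 : ℝ) / m * (1 / m)) atTop (𝓝 0) := by
      simpa using (tendsto_const_div_atTop_nhds_zero_nat (3 * 2 ^ 30 : ℝ)).mul
        (tendsto_const_div_atTop_nhds_zero_nat (1 : ℝ))
    refine squeeze_zero' (Eventually.of_forall fun n => by positivity) ?_ (h.comp hm)
    filter_upwards [hnm] with n ⟨h0, hn⟩
    calc 3 * (n : ℝ) ^ 3 / ((Nat.nthRoot 10 n ^ 8 : ℕ) : ℝ) ^ 4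
        ≤ 3 * ((2 * (Nat.nthRoot 10 n : ℝ)) ^ 10) ^ 3 /
          ((Nat.nthRoot 10 n ^ 8 : ℕ) : ℝ) ^ 4 := by gcongr
      _ = _ := by simp only [Function.comp]; push_cast; field_simp
  · refine squeeze_zero' (Eventually.of_forall fun n => by positivity) ?_
      (tendsto_two_mul_pow_mul_pow_pow.comp hm)
    filter_upwards [hnm] with n ⟨h0, hn⟩
    calc (n : ℝ) ^ (4 * Nat.nthRoot 10 n) * (15 / 16) ^ Nat.nthRoot 10 n ^ 2
        ≤ ((2 * (Nat.nthRoot 10 n : ℝ)) ^ 10) ^ (4 * Nat.nthRoot 10 n) *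
          (15 / 16) ^ Nat.nthRoot 10 n ^ 2 := by gcongr
      _ = _ := by
        simp only [Function.comp]
        rw [mul_pow _ _ (Nat.nthRoot 10 n), ← pow_mul, ← pow_mul, ← pow_mul, sq]
        congr 2
        ring

theorem mainTheorem5 :
    Tendsto
      (fun n : ℕ => randomGraphHalf n
        {G : SimpleGraph (Fin n) |
          (∀ H : SimpleGraph (Fin n), ¬ Nonempty (G ≃g H) →
            G.crColorSet 4 ∩ H.crColorSet 4 = ∅) ∧
          (∃ H : SimpleGraph (Fin n), ¬ Nonempty (G ≃g H) ∧
            G.crColorSet 3 ∩ H.crColorSet 3 ≠ ∅) ∧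
          (∀ H : SimpleGraph (Fin n), ¬ Nonempty (G ≃g H) →
            G.crColorSet 2 ≠ H.crColorSet 2)})
      atTop (𝓝 1) := by
  simp only [randomGraphHalf_eq_density]
  rw [← ENNReal.ofReal_one]
  refine ENNReal.tendsto_ofReal ?_
  refine tendsto_of_tendsto_of_tendsto_of_le_of_le' (f := fun n : ℕ => SimpleGraph.density _)
    (by simpa only [sub_zero] using tendsto_failure_bound.const_sub 1) tendsto_const_nhds ?_
    (Eventually.of_forall fun n => SimpleGraph.density_le_one _)
  -- The threshold 50 gives `6 ≤ M`; 34 makes `8 * (4 * m ^ 9 + 8 * m) + 2 ≤ m ^ 10`.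
  filter_upwards [(tendsto_nthRoot_atTop (r := 10) (by norm_num)).eventually_ge_atTop 34,
    eventually_ge_atTop 50] with n hm hn
  have hmn : Nat.nthRoot 10 n ^ 10 ≤ n := (Nat.le_nthRoot_iff (by norm_num)).1 le_rfl
  have h := SimpleGraph.density_not_typical_le (V := Fin n) (M := (n - 2) / 8)
    (k := Nat.nthRoot 10 n) (τ := Nat.nthRoot 10 n ^ 8) (by rw [Fintype.card_fin]; omega)
    (by omega) (by positivity) ?_
  · rw [SimpleGraph.density_not, Fintype.card_fin] at h
    linarith
  · generalize Nat.nthRoot 10 n = m at *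
    have h1 : 34 * m ^ 9 ≤ m ^ 10 := by
      rw [pow_succ' m 9]; exact Nat.mul_le_mul_right _ hm
    have h2 : 34 * m ≤ m ^ 9 := by
      calc 34 * m ≤ m ^ 8 * m := Nat.mul_le_mul_right _
            (hm.trans (Nat.le_self_pow (by norm_num) m))
        _ = m ^ 9 := by ring
    have h3 : (m ^ 8 + 2) * (4 * m) = 4 * m ^ 9 + 8 * m := by ring
    rw [h3]
    omega
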